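/- For $n\ge 1$ and $t\in(0,n]$ let $\mathscr T_n(t)=\{x\in[0,1]^n:\sum_{i=1}^n x_i\le t\}$ be the truncated cube, let $V_n(t)$ be its volume, and let $$P_n(t)=\frac{1}{n\,V_n(t)}\int_{\mathscr T_n(t)}\|x\|_1\,dx$$ be its average first moment. Let $\alpha\in(0,\tfrac12)$. Then for every $n\ge 1$ there is exactly one $t_n^\star\in(0,n]$ with $P_n(t_n^\star)=\alpha$, that is, $t_n^\star=P_n^{-1}(\alpha)$ is well defined; it is the parameter of the optimal shaping region, i.e. $\mathscr T_n(t_n^\star)$ has the largest volume among all closed sets $R\subseteq[0,1]^n$ of positive volume with $\frac{1}{\operatorname{vol}(R)}\int_R\|x\|_1\,dx\le n\alpha$. The equation $$\alpha=\frac1\mu-\frac{1}{e^\mu-1}$$ has a unique positive solution $\mu^*$, and the normalized optimal shaping parameter $\tau_n^\star=t_n^\star/n$ satisfies $$\tau_n^\star=\alpha+\frac{1}{\mu^*}\,\frac1n+o\!\left(\frac1n\right)\qquad(n\to\infty).$$ -/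

import Mathlib

open Filter Asymptotics MeasureTheory

noncomputable section

/-- The `n`-dimensional truncated cube: the points of the unit cube whose coordinate sum is at
most `t`. -/
def truncatedCube (n : ℕ) (t : ℝ) : Set (Fin n → ℝ) :=
  {x | (∀ i, x i ∈ Set.Icc (0 : ℝ) 1) ∧ ∑ i, x i ≤ t}

/-- The mean `ℓ¹`-norm of a point chosen uniformly at random in the region `R` (meaningful when
`R` has positive and finite volume). -/
def meanL1Norm (n : ℕ) (R : Set (Fin n → ℝ)) : ℝ :=
  1 / volume.real R * ∫ x in R, ∑ i, |x i|

/-- The average first moment `P_n(t)` of the truncated cube with parameter `t`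
(meaningful for `n ≥ 1` and `0 < t`, where the truncated cube has positive volume). -/
def averageFirstMoment (n : ℕ) (t : ℝ) : ℝ :=
  1 / n * meanL1Norm n (truncatedCube n t)

/-- The parameter `t_n^⋆ = P_n⁻¹(α)`, the inverse being taken of `P_n` on `(0, n]`. -/
def optimalShapingParameter (n : ℕ) (α : ℝ) : ℝ :=
  Function.invFunOn (averageFirstMoment n) (Set.Ioc 0 (n : ℝ)) α

/-- The admissible shaping regions: closed regions of positive volume in the unit cube
(peak constraint) whose mean `ℓ¹`-norm is at most `n α` (average constraint). -/
def IsShapingRegion (n : ℕ) (α : ℝ) (R : Set (Fin n → ℝ)) : Prop :=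
  IsClosed R ∧ (∀ x ∈ R, ∀ i, x i ∈ Set.Icc (0 : ℝ) 1) ∧ 0 < volume.real R ∧
    meanL1Norm n R ≤ n * α

/-- An optimal shaping region: an admissible region of maximal volume. -/
def IsOptimalShapingRegion (n : ℕ) (α : ℝ) (R : Set (Fin n → ℝ)) : Prop :=
  IsShapingRegion n α R ∧
    ∀ R' : Set (Fin n → ℝ), IsShapingRegion n α R' → volume.real R' ≤ volume.real R

end

/-! Write S for the coordinate sum, V_n(t) for the volume of the truncated cube and W_n(t) for
`excessIntegral n t`, the cube integral of (t - S)_+. For n ≥ 1, W_n is convex with W_n' = V_n, and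
n P_n(t) = t - W_n(t)/V_n(t) for t > 0. So P_n(t) = α means W_n(t)/V_n(t) = t - nα. Supporting lines
of W_n make P_n increasing, and a bathtub comparison gives optimality.

For the expansion, t_n^⋆ - nα → 1/μ must be shown. Two facts about W_n suffice: it is log-concave,
so V_n/W_n is nonincreasing on t > 0 (`volume_mul_excessIntegral_le`), and its Laplace transform is
L(r)^n / r^2 with L = `uniformLaplace` (`integral_exp_mul_excessIntegral`). Suppose V_n/W_n ≥ p > r
> μ at u = nα + y. Then e^{-pt} W_n(t) increases up to u, so the Laplace integral at r is controlled
by the integrand at u and the tail beyond u. Chernoff bounds at μ make both O(e^{-(r-μ)u} L(μ)^n).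
But L(r) e^{αr} has its strict minimum at μ, so L(r)^n is exponentially larger, a contradiction for
large n. The case p < r < μ is the mirror image. Taking p = 1/y places t_n^⋆ - nα on the correct
side of every y ≠ 1/μ. -/

/-! ### The excess integral and its recursion in the dimension -/

/-- The integral over the unit cube of the amount by which the coordinate sum stays below `t`. -/
noncomputable def excessIntegral (n : ℕ) (t : ℝ) : ℝ :=
  ∫ x in Set.Icc (0 : Fin n → ℝ) 1, max (t - ∑ i, x i) 0

lemma continuous_excess (n : ℕ) (t : ℝ) :
    Continuous fun x : Fin n → ℝ => max (t - ∑ i, x i) 0 := by fun_prop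

lemma integrableOn_excess (n : ℕ) (t : ℝ) :
    IntegrableOn (fun x : Fin n → ℝ => max (t - ∑ i, x i) 0) (Set.Icc 0 1) :=
  (continuous_excess n t).continuousOn.integrableOn_compact isCompact_Icc

lemma excessIntegral_zero (t : ℝ) : excessIntegral 0 t = max t 0 := by
  have h : Set.Icc (0 : Fin 0 → ℝ) 1 = Set.univ :=
    Set.eq_univ_of_forall fun x => ⟨fun i => i.elim0, fun i => i.elim0⟩
  rw [excessIntegral, h]
  simp [measureReal_def, volume_pi]

lemma excessIntegral_nonneg (n : ℕ) (t : ℝ) : 0 ≤ excessIntegral n t :=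
  integral_nonneg fun _ => le_max_right _ _

lemma excessIntegral_of_nonpos (n : ℕ) {t : ℝ} (ht : t ≤ 0) : excessIntegral n t = 0 := by
  refine setIntegral_eq_zero_of_forall_eq_zero fun x hx => max_eq_right ?_
  have : 0 ≤ ∑ i, x i := Finset.sum_nonneg fun i _ => hx.1 i
  linarith

/-- Fubini in the first coordinate x, followed by the substitution y = t - x. -/
lemma excessIntegral_succ (n : ℕ) (t : ℝ) :
    excessIntegral (n + 1) t = ∫ y in (t - 1)..t, excessIntegral n y := by
  have e := volume_preserving_piFinSuccAbove (fun _ : Fin (n + 1) => ℝ) 0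
  have hpre : Set.Icc (0 : Fin (n + 1) → ℝ) 1 =
      MeasurableEquiv.piFinSuccAbove (fun _ : Fin (n + 1) => ℝ) 0 ⁻¹'
        (Set.Icc (0 : ℝ) 1 ×ˢ Set.Icc (0 : Fin n → ℝ) 1) := by
    ext x
    simp [Pi.le_def, Fin.forall_fin_succ, MeasurableEquiv.piFinSuccAbove, Fin.insertNthEquiv]
    tauto
  have hcont : Continuous fun p : ℝ × (Fin n → ℝ) => max (t - (p.1 + ∑ i, p.2 i)) 0 := by
    fun_prop
  have h1 : excessIntegral (n + 1) t =
      ∫ p in Set.Icc (0 : ℝ) 1 ×ˢ Set.Icc (0 : Fin n → ℝ) 1,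
        max (t - (p.1 + ∑ i, p.2 i)) 0 := by
    rw [← e.setIntegral_preimage_emb (MeasurableEquiv.measurableEmbedding _), ← hpre]
    refine integral_congr_ae (ae_of_all _ fun x => ?_)
    simp [Fin.sum_univ_succ, MeasurableEquiv.piFinSuccAbove, Fin.insertNthEquiv, Fin.tail]
  rw [h1, Measure.volume_eq_prod, setIntegral_prod _
    (hcont.continuousOn.integrableOn_compact (isCompact_Icc.prod isCompact_Icc)),
    integral_Icc_eq_integral_Ioc, ← intervalIntegral.integral_of_le zero_le_one]
  have h2 := intervalIntegral.integral_comp_sub_left (a := 0) (b := 1) (excessIntegral n) t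
  rw [sub_zero] at h2
  rw [← h2]
  simp only [excessIntegral, sub_sub]

lemma continuous_excessIntegral : ∀ n, Continuous (excessIntegral n)
  | 0 => by
    have : excessIntegral 0 = fun t => max t 0 := funext excessIntegral_zero
    rw [this]; fun_prop
  | n + 1 => by
    have ih := continuous_excessIntegral n
    have h : excessIntegral (n + 1) = fun t =>
        (∫ y in (0 : ℝ)..t, excessIntegral n y) - ∫ y in (0 : ℝ)..(t - 1), excessIntegral n y := by
      ext t
      rw [excessIntegral_succ, intervalIntegral.integral_interval_sub_left] <;>
        exact ih.intervalIntegrable _ _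
    have hp : Continuous fun t => ∫ y in (0 : ℝ)..t, excessIntegral n y :=
      intervalIntegral.continuous_primitive (fun _ _ => ih.intervalIntegrable _ _) 0
    rw [h]
    exact hp.sub (hp.comp (continuous_id.sub continuous_const))

lemma hasDerivAt_windowIntegral {g : ℝ → ℝ} (hg : Continuous g) (t : ℝ) :
    HasDerivAt (fun t => ∫ y in (t - 1)..t, g y) (g t - g (t - 1)) t := by
  have h : (fun t : ℝ => ∫ y in (t - 1)..t, g y) = fun t =>
      (∫ y in (0 : ℝ)..t, g y) - ∫ y in (0 : ℝ)..(t - 1), g y := by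
    ext t
    rw [intervalIntegral.integral_interval_sub_left] <;> exact hg.intervalIntegrable _ _
  rw [h]
  have hp : ∀ u, HasDerivAt (fun t => ∫ y in (0 : ℝ)..t, g y) (g u) u := fun u =>
    intervalIntegral.integral_hasDerivAt_right (hg.intervalIntegrable _ _)
      (hg.stronglyMeasurableAtFilter _ _) hg.continuousAt
  exact (hp t).sub ((hp (t - 1)).comp_sub_const t 1)

lemma hasDerivAt_excessIntegral (n : ℕ) (t : ℝ) :
    HasDerivAt (excessIntegral (n + 1)) (excessIntegral n t - excessIntegral n (t - 1)) t := by
  have h : excessIntegral (n + 1) = fun t => ∫ y in (t - 1)..t, excessIntegral n y :=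
    funext (excessIntegral_succ n)
  rw [h]
  exact hasDerivAt_windowIntegral (continuous_excessIntegral n) t

lemma excessIntegral_of_ge : ∀ (n : ℕ) {t : ℝ}, n ≤ t → excessIntegral n t = t - n / 2
  | 0, t, h => by
    rw [excessIntegral_zero, max_eq_left (by simpa using h)]; simp
  | n + 1, t, h => by
    push_cast at h
    rw [excessIntegral_succ, intervalIntegral.integral_congr (g := fun y => y - n / 2)]
    · rw [intervalIntegral.integral_sub (by simp) (by simp)]
      simp
      ring
    · intro y hy
      rw [Set.uIcc_of_le (by linarith)] at hy
      exact excessIntegral_of_ge n (by linarith [hy.1])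

/-! ### Volume of the truncated cube as derivative of the excess integral -/

section TruncatedCube

variable (n : ℕ) (t : ℝ)

lemma truncatedCube_subset : truncatedCube n t ⊆ Set.Icc 0 1 :=
  fun _ hx => ⟨fun i => (hx.1 i).1, fun i => (hx.1 i).2⟩

lemma truncatedCube_eq : truncatedCube n t = Set.Icc 0 1 ∩ {x | ∑ i, x i ≤ t} := by
  ext x
  simp only [truncatedCube, Set.mem_ofPred_eq, Set.mem_inter_iff, Set.mem_Icc, Pi.le_def,
    forall_and, Pi.zero_apply, Pi.one_apply]

lemma isClosed_truncatedCube : IsClosed (truncatedCube n t) := by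
  rw [truncatedCube_eq]
  exact isClosed_Icc.inter (isClosed_le (by fun_prop) (by fun_prop))

lemma measurableSet_truncatedCube : MeasurableSet (truncatedCube n t) :=
  (isClosed_truncatedCube n t).measurableSet

lemma volume_ne_top_of_subset_cube {n : ℕ} {R : Set (Fin n → ℝ)} (h : R ⊆ Set.Icc 0 1) :
    volume R ≠ ⊤ :=
  ((measure_mono h).trans_lt isCompact_Icc.measure_lt_top).ne

lemma integrableOn_of_subset_cube {n : ℕ} {R : Set (Fin n → ℝ)} (h : R ⊆ Set.Icc 0 1)
    {f : (Fin n → ℝ) → ℝ} (hf : Continuous f) : IntegrableOn f R :=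
  (hf.continuousOn.integrableOn_compact isCompact_Icc).mono_set h

lemma excessIntegral_eq_setIntegral_truncatedCube :
    excessIntegral n t = ∫ x in truncatedCube n t, (t - ∑ i, x i) := by
  rw [excessIntegral, setIntegral_eq_of_subset_of_forall_sdiff_eq_zero measurableSet_Icc
    (truncatedCube_subset n t) (f := fun x : Fin n → ℝ => max (t - ∑ i, x i) 0)]
  · refine setIntegral_congr_fun (measurableSet_truncatedCube n t) fun x hx => ?_
    exact max_eq_left (sub_nonneg.2 hx.2)
  · intro x hx
    rw [truncatedCube_eq] at hx
    refine max_eq_right (sub_nonpos.2 (le_of_lt ?_))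
    by_contra h
    exact hx.2 ⟨hx.1, not_lt.1 h⟩

lemma setIntegral_truncatedCube :
    ∫ x in truncatedCube n t, ∑ i, |x i| =
      t * volume.real (truncatedCube n t) - excessIntegral n t := by
  have h := truncatedCube_subset n t
  rw [excessIntegral_eq_setIntegral_truncatedCube, integral_sub
    (integrableOn_of_subset_cube h continuous_const)
    (integrableOn_of_subset_cube h (by fun_prop))]
  rw [setIntegral_const, smul_eq_mul, mul_comm t, sub_sub_cancel]
  refine setIntegral_congr_fun (measurableSet_truncatedCube n t) fun x hx => ?_
  exact Finset.sum_congr rfl fun i _ => abs_of_nonneg (hx.1 i).1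

/-- The supporting line of the convex function W_n at t: (u - S)_+ is at least u - S on the
truncated cube and at least 0 off it. -/
lemma excessIntegral_add_le (u : ℝ) :
    excessIntegral n t + volume.real (truncatedCube n t) * (u - t) ≤ excessIntegral n u := by
  have h := truncatedCube_subset n t
  have h1 : excessIntegral n t + volume.real (truncatedCube n t) * (u - t) =
      ∫ x in truncatedCube n t, (u - ∑ i, x i) := by
    rw [excessIntegral_eq_setIntegral_truncatedCube, ← smul_eq_mul, ← setIntegral_const,
      ← integral_add (integrableOn_of_subset_cube h (by fun_prop))
        (integrableOn_of_subset_cube h continuous_const)]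
    refine integral_congr_ae (ae_of_all _ fun x => ?_)
    simp
  rw [h1]
  calc ∫ x in truncatedCube n t, (u - ∑ i, x i)
      ≤ ∫ x in truncatedCube n t, max (u - ∑ i, x i) 0 :=
        integral_mono (integrableOn_of_subset_cube h (by fun_prop))
          (integrableOn_of_subset_cube h (by fun_prop)) fun x => le_max_left _ _
    _ ≤ excessIntegral n u :=
        setIntegral_mono_set (integrableOn_excess n u) (ae_of_all _ fun x => le_max_right _ _)
          h.eventuallyLE

/-- The recursion already gives differentiability, and a differentiable function has only one
supporting slope. -/
lemma hasDerivAt_excessIntegral_volume :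
    HasDerivAt (excessIntegral (n + 1)) (volume.real (truncatedCube (n + 1) t)) t := by
  have hd := hasDerivAt_excessIntegral n t
  set v := volume.real (truncatedCube (n + 1) t) with hv
  have hmin : IsLocalMin (fun u => excessIntegral (n + 1) u - v * (u - t)) t := by
    refine Eventually.of_forall fun u => ?_
    have := excessIntegral_add_le (n + 1) t u
    simp only [sub_self, mul_zero, sub_zero]
    linarith
  have h0 := hmin.hasDerivAt_eq_zero
    (hd.sub (((hasDerivAt_id t).sub_const t).const_mul v))
  simp only [mul_one] at h0
  rwa [sub_eq_zero.1 h0] at hd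

lemma volume_truncatedCube_succ :
    volume.real (truncatedCube (n + 1) t) = excessIntegral n t - excessIntegral n (t - 1) :=
  (hasDerivAt_excessIntegral_volume n t).unique (hasDerivAt_excessIntegral n t)

end TruncatedCube

lemma continuous_volume_truncatedCube (n : ℕ) :
    Continuous fun t => volume.real (truncatedCube (n + 1) t) := by
  simp only [volume_truncatedCube_succ]
  have := continuous_excessIntegral n
  fun_prop

lemma truncatedCube_mono (n : ℕ) : Monotone (truncatedCube n) :=
  fun _ _ h _ hx => ⟨hx.1, hx.2.trans h⟩

lemma volume_truncatedCube_lt (n : ℕ) {s t : ℝ} (hs : 0 ≤ s) (hst : s < t) (ht : t ≤ n + 1) :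
    volume.real (truncatedCube (n + 1) s) < volume.real (truncatedCube (n + 1) t) := by
  set U : Set (Fin (n + 1) → ℝ) :=
    Set.pi Set.univ (fun _ => Set.Ioo 0 1) ∩ {x | s < ∑ i, x i ∧ ∑ i, x i < t} with hU
  have hopen : IsOpen U := by
    refine (isOpen_set_pi Set.finite_univ fun _ _ => isOpen_Ioo).inter ?_
    have hS : Continuous fun x : Fin (n + 1) → ℝ => ∑ i, x i := by fun_prop
    exact (isOpen_lt continuous_const hS).inter (isOpen_lt hS continuous_const)
  have hn : (0 : ℝ) < n + 1 := by positivity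
  have hne : U.Nonempty := by
    -- The diagonal point with coordinate sum (s + t)/2; it lies inside the cube because s < t ≤ n +
    -- 1.
    refine ⟨fun _ => (s + t) / 2 / (n + 1), fun i _ => ⟨?_, ?_⟩, ?_⟩
    · have : 0 < s + t := by linarith
      positivity
    · rw [div_lt_one hn]; linarith
    · have : ∑ _i : Fin (n + 1), (s + t) / 2 / ((n : ℝ) + 1) = (s + t) / 2 := by
        simp; field_simp
      simp only [Set.mem_ofPred_eq, this]
      constructor <;> linarith
  have hsub : U ⊆ truncatedCube (n + 1) t := fun x hx =>
    ⟨fun i => Set.Ioo_subset_Icc_self (hx.1 i trivial), hx.2.2.le⟩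
  have hdisj : Disjoint (truncatedCube (n + 1) s) U :=
    Set.disjoint_left.2 fun x h1 h2 => absurd h2.2.1 (not_lt.2 h1.2)
  have hfin := volume_ne_top_of_subset_cube (truncatedCube_subset (n + 1) t)
  have hUfin : volume U ≠ ⊤ := ((measure_mono hsub).trans_lt hfin.lt_top).ne
  have hpos : 0 < volume.real U :=
    ENNReal.toReal_pos (hopen.measure_pos volume hne).ne' hUfin
  have hunion := measureReal_union (μ := volume) hdisj hopen.measurableSet
    (volume_ne_top_of_subset_cube (truncatedCube_subset _ _)) hUfin
  have hle := measureReal_mono (μ := volume)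
    (Set.union_subset (truncatedCube_mono (n + 1) hst.le) hsub) hfin
  linarith

lemma volume_truncatedCube_pos (n : ℕ) {t : ℝ} (ht : 0 < t) :
    0 < volume.real (truncatedCube (n + 1) t) := by
  have h1 : (0 : ℝ) < min t (n + 1) := lt_min ht (by positivity)
  calc 0 ≤ volume.real (truncatedCube (n + 1) 0) := measureReal_nonneg
    _ < volume.real (truncatedCube (n + 1) (min t (n + 1))) :=
      volume_truncatedCube_lt n le_rfl h1 (min_le_right _ _)
    _ ≤ _ := measureReal_mono (truncatedCube_mono _ (min_le_left _ _))
      (volume_ne_top_of_subset_cube (truncatedCube_subset _ _))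

lemma excessIntegral_succ_pos (n : ℕ) {t : ℝ} (ht : 0 < t) : 0 < excessIntegral (n + 1) t := by
  have h1 := excessIntegral_add_le (n + 1) (t / 2) t
  have h2 := volume_truncatedCube_pos n (half_pos ht)
  have h3 := excessIntegral_nonneg (n + 1) (t / 2)
  nlinarith

lemma excessIntegral_pos : ∀ (n : ℕ) {t : ℝ}, 0 < t → 0 < excessIntegral n t
  | 0, t, ht => by rw [excessIntegral_zero]; exact lt_max_of_lt_left ht
  | n + 1, _, ht => excessIntegral_succ_pos n ht

lemma excessIntegral_mono (n : ℕ) : Monotone (excessIntegral n) := fun s t h => by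
  have h1 := excessIntegral_add_le n s t
  have h2 : 0 ≤ volume.real (truncatedCube n s) * (t - s) :=
    mul_nonneg measureReal_nonneg (sub_nonneg.2 h)
  linarith

lemma volume_truncatedCube_self (n : ℕ) :
    volume.real (truncatedCube (n + 1) (n + 1)) = 1 := by
  rw [volume_truncatedCube_succ, excessIntegral_of_ge n (by linarith),
    excessIntegral_of_ge n (by linarith)]
  ring

/-! ### The average first moment, its inverse, and optimality -/

lemma averageFirstMoment_succ (n : ℕ) {t : ℝ} (ht : 0 < t) :
    averageFirstMoment (n + 1) t =
      (t - excessIntegral (n + 1) t / volume.real (truncatedCube (n + 1) t)) / (n + 1) := by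
  have hV := volume_truncatedCube_pos n ht
  have hn : (n : ℝ) + 1 ≠ 0 := by positivity
  rw [averageFirstMoment, meanL1Norm, setIntegral_truncatedCube]
  push_cast
  field_simp

/-- The supporting line at t, evaluated at s, gives V(t)(t - s) - W(t) ≥ -W(s). Strict and weak
monotonicity of P both follow. -/
lemma mul_div_volume_le_averageFirstMoment_sub (n : ℕ) {s t : ℝ} (hs : 0 < s) (hst : s ≤ t) :
    excessIntegral (n + 1) s / volume.real (truncatedCube (n + 1) s) *
        (volume.real (truncatedCube (n + 1) t) - volume.real (truncatedCube (n + 1) s)) ≤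
      volume.real (truncatedCube (n + 1) t) * ((n + 1) *
        (averageFirstMoment (n + 1) t - averageFirstMoment (n + 1) s)) := by
  have ht := hs.trans_le hst
  have hVs := volume_truncatedCube_pos n hs
  have hVt := volume_truncatedCube_pos n ht
  have hn : (0 : ℝ) < n + 1 := by positivity
  have h := excessIntegral_add_le (n + 1) t s
  rw [averageFirstMoment_succ n hs, averageFirstMoment_succ n ht]
  set W := excessIntegral (n + 1)
  set Vs := volume.real (truncatedCube (n + 1) s)
  set Vt := volume.real (truncatedCube (n + 1) t)
  have e : Vt * ((n + 1) * ((t - W t / Vt) / (n + 1) - (s - W s / Vs) / (n + 1))) =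
      Vt * (t - s) - W t + W s / Vs * Vt := by
    field_simp
    ring
  have e2 : W s / Vs * (Vt - Vs) = W s / Vs * Vt - W s := by
    field_simp
  rw [e, e2]
  linarith

lemma averageFirstMoment_strictMonoOn (n : ℕ) :
    StrictMonoOn (averageFirstMoment (n + 1)) (Set.Ioc 0 (n + 1)) := by
  intro s hs t ht hst
  have h := mul_div_volume_le_averageFirstMoment_sub n hs.1 hst.le
  have h1 := volume_truncatedCube_lt n hs.1.le hst ht.2
  have h2 : 0 < excessIntegral (n + 1) s / volume.real (truncatedCube (n + 1) s) :=
    div_pos (excessIntegral_succ_pos n hs.1) (volume_truncatedCube_pos n hs.1)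
  have h3 := (mul_pos h2 (sub_pos.2 h1)).trans_le h
  rw [mul_pos_iff_of_pos_left (volume_truncatedCube_pos n ht.1),
    mul_pos_iff_of_pos_left (by positivity)] at h3
  exact sub_pos.1 h3

/-- The weak form has no upper limit on t, since the later test points (n + 1)α + y may exceed n +
1. -/
lemma averageFirstMoment_monotoneOn (n : ℕ) :
    MonotoneOn (averageFirstMoment (n + 1)) (Set.Ioi 0) := by
  intro s hs t ht hst
  have h := mul_div_volume_le_averageFirstMoment_sub n hs hst
  have h1 : volume.real (truncatedCube (n + 1) s) ≤ volume.real (truncatedCube (n + 1) t) :=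
    measureReal_mono (truncatedCube_mono _ hst)
      (volume_ne_top_of_subset_cube (truncatedCube_subset _ _))
  have h2 : 0 < excessIntegral (n + 1) s / volume.real (truncatedCube (n + 1) s) :=
    div_pos (excessIntegral_succ_pos n hs) (volume_truncatedCube_pos n hs)
  have h3 := (mul_nonneg h2.le (sub_nonneg.2 h1)).trans h
  rw [mul_nonneg_iff_of_pos_left (volume_truncatedCube_pos n ht),
    mul_nonneg_iff_of_pos_left (by positivity)] at h3
  exact sub_nonneg.1 h3

lemma existsUnique_averageFirstMoment_eq {α : ℝ} (hα : α ∈ Set.Ioo (0 : ℝ) (1 / 2)) (n : ℕ) :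
    ∃! t : ℝ, t ∈ Set.Ioc (0 : ℝ) (n + 1) ∧ averageFirstMoment (n + 1) t = α := by
  have hn : (0 : ℝ) < n + 1 := by positivity
  have ha : 0 < (n + 1) * α := mul_pos hn hα.1
  have hle : (n + 1) * α ≤ n + 1 := by nlinarith [hα.2]
  have hpos : ∀ t ∈ Set.Icc ((n + 1) * α) (n + 1), 0 < t := fun t ht => ha.trans_le ht.1
  have hcont : ContinuousOn (averageFirstMoment (n + 1)) (Set.Icc ((n + 1) * α) (n + 1)) := by
    refine ContinuousOn.congr ?_ fun t ht => averageFirstMoment_succ n (hpos t ht)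
    refine (continuousOn_id.sub ((continuous_excessIntegral _).continuousOn.div
      (continuous_volume_truncatedCube n).continuousOn fun t ht => ?_)).div_const _
    exact (volume_truncatedCube_pos n (hpos t ht)).ne'
  have hlow : averageFirstMoment (n + 1) ((n + 1) * α) ≤ α := by
    rw [averageFirstMoment_succ n ha, div_le_iff₀ hn]
    have := div_nonneg (excessIntegral_nonneg (n + 1) ((n + 1) * α))
      (measureReal_nonneg (μ := volume) (s := truncatedCube (n + 1) ((n + 1) * α)))
    linarith
  -- For the whole cube the average first moment is 1/2.
  have hhigh : α ≤ averageFirstMoment (n + 1) (n + 1) := by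
    rw [averageFirstMoment_succ n hn, volume_truncatedCube_self,
      excessIntegral_of_ge (n + 1) (by push_cast; rfl), le_div_iff₀ hn]
    push_cast
    nlinarith [hα.2]
  obtain ⟨t, ht, hteq⟩ := intermediate_value_Icc hle hcont ⟨hlow, hhigh⟩
  have htm : t ∈ Set.Ioc (0 : ℝ) (n + 1) := ⟨hpos t ht, ht.2⟩
  exact ⟨t, ⟨htm, hteq⟩, fun s hs =>
    (averageFirstMoment_strictMonoOn n).injOn hs.1 htm (hs.2.trans hteq.symm)⟩

lemma optimalShapingParameter_spec {α : ℝ} (hα : α ∈ Set.Ioo (0 : ℝ) (1 / 2)) (n : ℕ) :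
    optimalShapingParameter (n + 1) α ∈ Set.Ioc (0 : ℝ) (n + 1) ∧
      averageFirstMoment (n + 1) (optimalShapingParameter (n + 1) α) = α := by
  obtain ⟨t, ⟨ht, hteq⟩, -⟩ := existsUnique_averageFirstMoment_eq hα n
  have h : ∃ t ∈ Set.Ioc (0 : ℝ) ((n + 1 : ℕ) : ℝ), averageFirstMoment (n + 1) t = α :=
    ⟨t, by push_cast; exact ht, hteq⟩
  have h1 := Function.invFunOn_mem h
  push_cast at h1
  refine ⟨?_, Function.invFunOn_eq h⟩
  unfold optimalShapingParameter
  push_cast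
  exact h1

/-- Bathtub principle: for admissible R, with N = n + 1, (t - Nα) vol R ≤ ∫_R (t - S) ≤ W(t) = (t -
Nα) V(t), and t - Nα > 0. -/
lemma isOptimalShapingRegion_truncatedCube {n : ℕ} {α t : ℝ} (ht : 0 < t)
    (h : averageFirstMoment (n + 1) t = α) :
    IsOptimalShapingRegion (n + 1) α (truncatedCube (n + 1) t) := by
  have hn : (0 : ℝ) < n + 1 := by positivity
  have hV := volume_truncatedCube_pos n ht
  have hW := excessIntegral_succ_pos n ht
  have hexc : excessIntegral (n + 1) t =
      (t - (n + 1) * α) * volume.real (truncatedCube (n + 1) t) := by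
    rw [← h, averageFirstMoment_succ n ht]
    field_simp
    ring
  have hta : 0 < t - (n + 1) * α := by
    rw [hexc] at hW
    exact pos_of_mul_pos_left hW hV.le
  refine ⟨⟨isClosed_truncatedCube _ _, fun x hx => hx.1, hV, ?_⟩, ?_⟩
  · rw [← h, averageFirstMoment]
    push_cast
    field_simp
    rfl
  · rintro R ⟨hcl, hsub, hpos, hmean⟩
    have hR : R ⊆ Set.Icc 0 1 := fun x hx =>
      ⟨fun i => (hsub x hx i).1, fun i => (hsub x hx i).2⟩
    have hmean' : ∫ x in R, ∑ i, |x i| ≤ (n + 1) * α * volume.real R := by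
      rw [meanL1Norm, one_div, inv_mul_le_iff₀ hpos] at hmean
      push_cast at hmean
      linarith
    have hint : t * volume.real R - ∫ x in R, ∑ i, |x i| ≤ excessIntegral (n + 1) t := by
      calc t * volume.real R - ∫ x in R, ∑ i, |x i|
          = ∫ x in R, (t - ∑ i, |x i|) := by
            rw [integral_sub (integrableOn_of_subset_cube hR continuous_const)
              (integrableOn_of_subset_cube hR (by fun_prop)), setIntegral_const, smul_eq_mul,
              mul_comm]
        _ ≤ ∫ x in R, max (t - ∑ i, x i) 0 := by
            refine integral_mono (integrableOn_of_subset_cube hR (by fun_prop))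
              (integrableOn_of_subset_cube hR (by fun_prop)) fun x => le_max_of_le_left ?_
            exact sub_le_sub_left (Finset.sum_le_sum fun i _ => le_abs_self _) _
        _ ≤ excessIntegral (n + 1) t :=
            setIntegral_mono_set (integrableOn_excess _ t)
              (ae_of_all _ fun x => le_max_right _ _) hR.eventuallyLE
    rw [hexc] at hint
    refine le_of_mul_le_mul_left ?_ hta
    linarith

/-! ### Log-concavity of the excess integral -/

/-- Log-concavity of a nonnegative function on the line, in its multiplicative form. -/
def IsLogConcave (g : ℝ → ℝ) : Prop :=
  ∀ a b c d, a ≤ b → a ≤ c → a + d = b + c → g a * g d ≤ g b * g c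

/-- For G(t) = ∫_{t-1}^t g this says that G'/G is nonincreasing. With windows written as integrals
of g(u - x) over x in [0,1], it already holds pointwise in x. -/
lemma IsLogConcave.window_ineq {g : ℝ → ℝ} (hg : IsLogConcave g) (hc : Continuous g) {s t : ℝ}
    (hst : s ≤ t) :
    (g t - g (t - 1)) * (∫ y in (s - 1)..s, g y) ≤
      (g s - g (s - 1)) * ∫ y in (t - 1)..t, g y := by
  have h : ∀ u, ∫ y in (u - 1)..u, g y = ∫ x in (0 : ℝ)..1, g (u - x) := fun u => by
    rw [intervalIntegral.integral_comp_sub_left, sub_zero]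
  rw [h, h, ← intervalIntegral.integral_const_mul, ← intervalIntegral.integral_const_mul]
  refine intervalIntegral.integral_mono_on zero_le_one
    (Continuous.intervalIntegrable (by fun_prop) _ _)
    (Continuous.intervalIntegrable (by fun_prop) _ _) fun x hx => ?_
  have h1 := hg (s - x) s (t - x) t (by linarith [hx.1]) (by linarith) (by ring)
  have h2 := hg (s - 1) (t - 1) (s - x) (t - x) (by linarith) (by linarith [hx.2]) (by ring)
  nlinarith

/-- Where G > 0, a nonincreasing G'/G makes G(x + h)/G(x) nonincreasing in x for h ≥ 0; take h = b -
a and compare x = a with x = c. -/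
lemma isLogConcave_of_deriv {G G' : ℝ → ℝ} (hG : ∀ t, HasDerivAt G (G' t) t)
    (h0 : ∀ t ≤ 0, G t = 0) (hpos : ∀ t, 0 < t → 0 < G t)
    (h : ∀ s t, s ≤ t → G' t * G s ≤ G' s * G t) : IsLogConcave G := by
  have hnn : ∀ t, 0 ≤ G t := fun t => by
    rcases le_or_gt t 0 with ht | ht
    · exact (h0 t ht).ge
    · exact (hpos t ht).le
  intro a b c d hab hac hsum
  rcases le_or_gt a 0 with ha | ha
  · rw [h0 a ha, zero_mul]
    exact mul_nonneg (hnn b) (hnn c)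
  have hr : 0 ≤ b - a := sub_nonneg.2 hab
  have hd : ∀ x, 0 < x → HasDerivAt (fun x => G (x + (b - a)) / G x)
      ((G' (x + (b - a)) * G x - G (x + (b - a)) * G' x) / G x ^ 2) x := fun x hx =>
    ((hG _).comp_add_const x (b - a)).div (hG x) (hpos x hx).ne'
  have hanti : AntitoneOn (fun x => G (x + (b - a)) / G x) (Set.Ioi 0) := by
    refine antitoneOn_of_deriv_nonpos (convex_Ioi 0)
      (fun x hx => (hd x hx).continuousAt.continuousWithinAt)
      (fun x hx => ?_) (fun x hx => ?_) <;> rw [interior_Ioi] at hx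
    · exact (hd x hx).differentiableAt.differentiableWithinAt
    · rw [(hd x hx).deriv]
      refine div_nonpos_of_nonpos_of_nonneg ?_ (sq_nonneg _)
      have := h x (x + (b - a)) (by linarith)
      linarith
  have hc : 0 < c := ha.trans_le hac
  have key := hanti (Set.mem_Ioi.2 ha) (Set.mem_Ioi.2 hc) hac
  simp only at key
  rw [show c + (b - a) = d by linarith, show a + (b - a) = b by ring,
    div_le_div_iff₀ (hpos c hc) (hpos a ha)] at key
  linarith

lemma isLogConcave_excessIntegral : ∀ n, IsLogConcave (excessIntegral n)
  | 0 => by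
    intro a b c d hab hac hsum
    simp only [excessIntegral_zero]
    rcases le_or_gt a 0 with ha | ha
    · rw [max_eq_right ha, zero_mul]; positivity
    · rw [max_eq_left ha.le, max_eq_left (by linarith), max_eq_left (by linarith),
        max_eq_left (by linarith)]
      nlinarith
  | n + 1 => by
    refine isLogConcave_of_deriv (hasDerivAt_excessIntegral n)
      (fun t => excessIntegral_of_nonpos _) (fun t => excessIntegral_pos _) fun s t hst => ?_
    rw [excessIntegral_succ, excessIntegral_succ]
    exact (isLogConcave_excessIntegral n).window_ineq (continuous_excessIntegral n) hst

lemma volume_mul_excessIntegral_le (n : ℕ) {s t : ℝ} (hst : s ≤ t) :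
    volume.real (truncatedCube (n + 1) t) * excessIntegral (n + 1) s ≤
      volume.real (truncatedCube (n + 1) s) * excessIntegral (n + 1) t := by
  rw [excessIntegral_succ, excessIntegral_succ, volume_truncatedCube_succ,
    volume_truncatedCube_succ]
  exact (isLogConcave_excessIntegral n).window_ineq (continuous_excessIntegral n) hst

lemma hasDerivAt_exp_mul_excessIntegral (n : ℕ) (r t : ℝ) :
    HasDerivAt (fun t => Real.exp (-(r * t)) * excessIntegral (n + 1) t)
      (Real.exp (-(r * t)) * (volume.real (truncatedCube (n + 1) t) -
        r * excessIntegral (n + 1) t)) t := by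
  have h1 : HasDerivAt (fun t : ℝ => Real.exp (-(r * t))) (Real.exp (-(r * t)) * -(r * 1)) t :=
    (((hasDerivAt_id t).const_mul r).neg).exp
  refine (h1.mul (hasDerivAt_excessIntegral_volume n t)).congr_deriv ?_
  ring

/-- As V/W is nonincreasing, a lower bound r at u persists to the left of u, and V - rW carries the
sign of the derivative. -/
lemma monotoneOn_exp_mul_excessIntegral (n : ℕ) {r u : ℝ} (hu : 0 < u)
    (h : r * excessIntegral (n + 1) u ≤ volume.real (truncatedCube (n + 1) u)) :
    MonotoneOn (fun t => Real.exp (-(r * t)) * excessIntegral (n + 1) t) (Set.Iic u) := by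
  have hd := hasDerivAt_exp_mul_excessIntegral n r
  refine monotoneOn_of_deriv_nonneg (convex_Iic u)
    (fun x _ => (hd x).continuousAt.continuousWithinAt)
    (fun x _ => (hd x).differentiableAt.differentiableWithinAt) (fun x hx => ?_)
  rw [interior_Iic] at hx
  rw [(hd x).deriv]
  refine mul_nonneg (Real.exp_nonneg _) (sub_nonneg.2 ?_)
  have h1 := volume_mul_excessIntegral_le n (le_of_lt hx)
  have h2 := mul_le_mul_of_nonneg_right h (excessIntegral_nonneg (n + 1) x)
  refine le_of_mul_le_mul_right ?_ (excessIntegral_succ_pos n hu)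
  linarith

lemma antitoneOn_exp_mul_excessIntegral (n : ℕ) {r u : ℝ} (hu : 0 < u)
    (h : volume.real (truncatedCube (n + 1) u) ≤ r * excessIntegral (n + 1) u) :
    AntitoneOn (fun t => Real.exp (-(r * t)) * excessIntegral (n + 1) t) (Set.Ici u) := by
  have hd := hasDerivAt_exp_mul_excessIntegral n r
  refine antitoneOn_of_deriv_nonpos (convex_Ici u)
    (fun x _ => (hd x).continuousAt.continuousWithinAt)
    (fun x _ => (hd x).differentiableAt.differentiableWithinAt) (fun x hx => ?_)
  rw [interior_Ici] at hx
  rw [(hd x).deriv]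
  refine mul_nonpos_of_nonneg_of_nonpos (Real.exp_nonneg _) (sub_nonpos.2 ?_)
  have h1 := volume_mul_excessIntegral_le n (le_of_lt hx)
  have h2 := mul_le_mul_of_nonneg_right h (excessIntegral_nonneg (n + 1) x)
  refine le_of_mul_le_mul_right ?_ (excessIntegral_succ_pos n hu)
  linarith

/-! ### The Laplace transform of the excess integral -/

lemma excessIntegral_le (n : ℕ) (t : ℝ) : excessIntegral n t ≤ max t 0 := by
  calc excessIntegral n t ≤ ∫ _x in Set.Icc (0 : Fin n → ℝ) 1, max t 0 := by
        refine setIntegral_mono_on (integrableOn_excess n t)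
          (continuousOn_const.integrableOn_compact isCompact_Icc) measurableSet_Icc fun x hx => ?_
        have : 0 ≤ ∑ i, x i := Finset.sum_nonneg fun i _ => hx.1 i
        exact max_le_max_right _ (by linarith)
    _ = max t 0 := by
        simp [measureReal_def, Real.volume_Icc_pi]

lemma exp_mul_excessIntegral_nonneg (n : ℕ) (r t : ℝ) :
    0 ≤ Real.exp (-(r * t)) * excessIntegral n t :=
  mul_nonneg (Real.exp_nonneg _) (excessIntegral_nonneg n t)

lemma exp_mul_excessIntegral_le (n : ℕ) {r : ℝ} (hr : 0 < r) (t : ℝ) :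
    Real.exp (-(r * t)) * excessIntegral n t ≤ 2 / r * Real.exp (-(r / 2) * t) := by
  have h1 : max t 0 ≤ 2 / r * Real.exp (r / 2 * t) := by
    refine max_le ?_ (by positivity)
    have := Real.add_one_le_exp (r / 2 * t)
    calc t = 2 / r * (r / 2 * t) := by field_simp
      _ ≤ _ := by gcongr; linarith
  calc Real.exp (-(r * t)) * excessIntegral n t
      ≤ Real.exp (-(r * t)) * (2 / r * Real.exp (r / 2 * t)) := by
        gcongr
        exact (excessIntegral_le n t).trans h1
    _ = 2 / r * (Real.exp (-(r * t)) * Real.exp (r / 2 * t)) := by ring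
    _ = _ := by rw [← Real.exp_add]; ring_nf

lemma integrable_exp_mul_excessIntegral (n : ℕ) {r : ℝ} (hr : 0 < r) :
    Integrable fun t => Real.exp (-(r * t)) * excessIntegral n t := by
  have hc : Continuous fun t => Real.exp (-(r * t)) * excessIntegral n t := by
    have := continuous_excessIntegral n
    fun_prop
  rw [← integrableOn_univ, ← Set.Iic_union_Ioi (a := (0 : ℝ))]
  refine IntegrableOn.union ?_ ?_
  · refine integrableOn_zero.congr_fun (fun t ht => ?_) measurableSet_Iic
    simp [excessIntegral_of_nonpos n (Set.mem_Iic.1 ht)]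
  · refine Integrable.mono' ((integrableOn_exp_mul_Ioi (a := -(r / 2)) (by linarith) 0).const_mul
      (2 / r)) hc.aestronglyMeasurable (ae_of_all _ fun t => ?_)
    rw [Real.norm_of_nonneg (exp_mul_excessIntegral_nonneg n r t)]
    exact exp_mul_excessIntegral_le n hr t

lemma tendsto_exp_mul_excessIntegral_atBot (n : ℕ) (r : ℝ) :
    Tendsto (fun t => Real.exp (-(r * t)) * excessIntegral n t) atBot (nhds 0) := by
  refine tendsto_const_nhds.congr' ?_
  filter_upwards [eventually_le_atBot 0] with t ht
  rw [excessIntegral_of_nonpos n ht, mul_zero]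

lemma tendsto_exp_mul_excessIntegral_atTop (n : ℕ) {r : ℝ} (hr : 0 < r) :
    Tendsto (fun t => Real.exp (-(r * t)) * excessIntegral n t) atTop (nhds 0) := by
  refine squeeze_zero (exp_mul_excessIntegral_nonneg n r) (exp_mul_excessIntegral_le n hr) ?_
  rw [← mul_zero (2 / r)]
  refine (Real.tendsto_exp_atBot.comp ?_).const_mul _
  exact tendsto_id.const_mul_atTop_of_neg (by linarith)

lemma integral_exp_mul_excessIntegral_zero {r : ℝ} (hr : 0 < r) :
    ∫ t, Real.exp (-(r * t)) * excessIntegral 0 t = 1 / r ^ 2 := by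
  have h := Real.integral_rpow_mul_exp_neg_mul_Ioi (a := 2) (by norm_num) hr
  rw [← setIntegral_eq_integral_of_forall_compl_eq_zero (s := Set.Ioi 0)
    (fun t ht => by rw [excessIntegral_of_nonpos 0 (not_lt.1 ht), mul_zero])]
  rw [Real.Gamma_two, mul_one] at h
  rw [show (1 : ℝ) / r ^ 2 = (1 / r) ^ (2 : ℝ) by norm_num, ← h]
  refine setIntegral_congr_fun measurableSet_Ioi fun t ht => ?_
  have : (2 : ℝ) - 1 = 1 := by norm_num
  simp only [excessIntegral_zero, max_eq_left (le_of_lt (Set.mem_Ioi.1 ht)), this, Real.rpow_one]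
  ring

/-- The Laplace transform of the uniform distribution on the unit interval. -/
noncomputable def uniformLaplace (r : ℝ) : ℝ := (1 - Real.exp (-r)) / r

lemma uniformLaplace_pos {r : ℝ} (hr : 0 < r) : 0 < uniformLaplace r :=
  div_pos (sub_pos.2 (by simpa using hr)) hr

lemma integral_exp_mul_excessIntegral {r : ℝ} (hr : 0 < r) : ∀ n,
    ∫ t, Real.exp (-(r * t)) * excessIntegral n t = uniformLaplace r ^ n / r ^ 2
  | 0 => by rw [integral_exp_mul_excessIntegral_zero hr, pow_zero]
  | n + 1 => by
    have ih := integral_exp_mul_excessIntegral hr n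
    have hi := integrable_exp_mul_excessIntegral n hr
    have hi1 := integrable_exp_mul_excessIntegral (n + 1) hr
    have hshift : (fun t => Real.exp (-(r * t)) * excessIntegral n (t - 1)) = fun t =>
        Real.exp (-r) * (Real.exp (-(r * (t - 1))) * excessIntegral n (t - 1)) := by
      ext t
      rw [← mul_assoc, ← Real.exp_add]
      ring_nf
    have his : Integrable fun t => Real.exp (-(r * t)) * excessIntegral n (t - 1) := by
      rw [hshift]
      exact (hi.comp_sub_right 1).const_mul _
    have hs : ∫ t, Real.exp (-(r * t)) * excessIntegral n (t - 1) =
        Real.exp (-r) * (uniformLaplace r ^ n / r ^ 2) := by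
      rw [hshift, integral_const_mul, ← ih,
        integral_sub_right_eq_self (fun t => Real.exp (-(r * t)) * excessIntegral n t)]
    have hd : ∀ t, HasDerivAt (fun t => Real.exp (-(r * t)) * excessIntegral (n + 1) t)
        (Real.exp (-(r * t)) * excessIntegral n t -
          Real.exp (-(r * t)) * excessIntegral n (t - 1) -
          r * (Real.exp (-(r * t)) * excessIntegral (n + 1) t)) t := fun t => by
      refine (hasDerivAt_exp_mul_excessIntegral n r t).congr_deriv ?_
      rw [volume_truncatedCube_succ]
      ring
    -- The derivative of e^{-rt} W_{n+1}(t) has integral 0; by the recursion this equates r times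
    -- the new transform with (1 - e^{-r}) times the old one.
    have h := integral_of_hasDerivAt_of_tendsto hd ((hi.sub his).sub (hi1.const_mul r))
      (tendsto_exp_mul_excessIntegral_atBot _ r) (tendsto_exp_mul_excessIntegral_atTop _ hr)
    have hsub : Integrable fun t => Real.exp (-(r * t)) * excessIntegral n t -
        Real.exp (-(r * t)) * excessIntegral n (t - 1) := hi.sub his
    rw [integral_sub hsub (hi1.const_mul r), integral_sub hi his, integral_const_mul, ih,
      hs, sub_zero, sub_eq_zero] at h
    rw [pow_succ, uniformLaplace]
    rw [uniformLaplace] at h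
    field_simp
    field_simp at h
    linarith

/-! ### Chernoff bounds and the two-sided comparison -/

/-- Since W_n is monotone, the integrand on (u, u + 1] is at least e^{-q} times its value at u;
hence the factor e^q. -/
lemma exp_mul_excessIntegral_le_laplace (n : ℕ) {q : ℝ} (hq : 0 < q) (u : ℝ) :
    Real.exp (-(q * u)) * excessIntegral n u ≤ Real.exp q * (uniformLaplace q ^ n / q ^ 2) := by
  have hi := integrable_exp_mul_excessIntegral n hq
  have h1 : Real.exp (-q) * (Real.exp (-(q * u)) * excessIntegral n u) ≤
      ∫ t in Set.Ioc u (u + 1), Real.exp (-(q * t)) * excessIntegral n t := by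
    have : ∫ _t in Set.Ioc u (u + 1), Real.exp (-q) * (Real.exp (-(q * u)) * excessIntegral n u) =
        Real.exp (-q) * (Real.exp (-(q * u)) * excessIntegral n u) := by simp
    rw [← this]
    refine setIntegral_mono_on (integrableOn_const (by simp)) hi.integrableOn measurableSet_Ioc
      fun t ht => ?_
    rw [← mul_assoc, ← Real.exp_add]
    have := ht.2
    gcongr
    · exact excessIntegral_nonneg n u
    · nlinarith
    · exact excessIntegral_mono n ht.1.le
  have h2 := setIntegral_le_integral (s := Set.Ioc u (u + 1)) hi
    (ae_of_all _ (exp_mul_excessIntegral_nonneg n q))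
  rw [integral_exp_mul_excessIntegral hq] at h2
  rw [Real.exp_neg q] at h1
  rw [← inv_mul_le_iff₀ (Real.exp_pos q)]
  exact h1.trans h2

/-- The hypothesis on s covers right tails when r > q and left tails when r < q. -/
lemma setIntegral_exp_mul_le_of_forall (n : ℕ) {q r : ℝ} (hq : 0 < q) (hr : 0 < r) (u : ℝ)
    {s : Set ℝ} (hs : MeasurableSet s) (h : ∀ t ∈ s, (r - q) * u ≤ (r - q) * t) :
    ∫ t in s, Real.exp (-(r * t)) * excessIntegral n t ≤
      Real.exp (-((r - q) * u)) * (uniformLaplace q ^ n / q ^ 2) := by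
  have hi := integrable_exp_mul_excessIntegral n hq
  calc ∫ t in s, Real.exp (-(r * t)) * excessIntegral n t
      ≤ ∫ t in s, Real.exp (-((r - q) * u)) * (Real.exp (-(q * t)) * excessIntegral n t) := by
        refine setIntegral_mono_on (integrable_exp_mul_excessIntegral n hr).integrableOn
          (hi.const_mul _).integrableOn hs fun t ht => ?_
        rw [← mul_assoc, ← Real.exp_add]
        have := h t ht
        gcongr
        · exact excessIntegral_nonneg n t
        · linarith
    _ ≤ ∫ t, Real.exp (-((r - q) * u)) * (Real.exp (-(q * t)) * excessIntegral n t) :=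
        setIntegral_le_integral (hi.const_mul _) (ae_of_all _ fun t =>
          mul_nonneg (Real.exp_nonneg _) (exp_mul_excessIntegral_nonneg n q t))
    _ = _ := by rw [integral_const_mul, integral_exp_mul_excessIntegral hq]

lemma exp_mul_excessIntegral_le_exp_mul_laplace (n : ℕ) {q r : ℝ} (hq : 0 < q) (u : ℝ) :
    Real.exp (-(r * u)) * excessIntegral n u ≤
      Real.exp (-((r - q) * u)) * (Real.exp q * (uniformLaplace q ^ n / q ^ 2)) := by
  calc Real.exp (-(r * u)) * excessIntegral n u
      = Real.exp (-((r - q) * u)) * (Real.exp (-(q * u)) * excessIntegral n u) := by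
        rw [← mul_assoc, ← Real.exp_add]; ring_nf
    _ ≤ _ := mul_le_mul_of_nonneg_left (exp_mul_excessIntegral_le_laplace n hq u) (Real.exp_nonneg _)

/-- Left of u the integrand is at most its value at u times e^{-(p-r)(u-t)}, by monotonicity of
e^{-pt} W(t). -/
lemma setIntegral_Iic_exp_mul_excessIntegral_le (n : ℕ) {r p u : ℝ} (hr : 0 < r) (hrp : r < p)
    (hu : 0 < u) (h : p * excessIntegral (n + 1) u ≤ volume.real (truncatedCube (n + 1) u)) :
    ∫ t in Set.Iic u, Real.exp (-(r * t)) * excessIntegral (n + 1) t ≤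
      Real.exp (-(r * u)) * excessIntegral (n + 1) u / (p - r) := by
  have hpr := sub_pos.2 hrp
  have hmono := monotoneOn_exp_mul_excessIntegral n hu h
  calc ∫ t in Set.Iic u, Real.exp (-(r * t)) * excessIntegral (n + 1) t
      ≤ ∫ t in Set.Iic u, Real.exp ((p - r) * t) *
          (Real.exp (-(p * u)) * excessIntegral (n + 1) u) := by
        refine setIntegral_mono_on (integrable_exp_mul_excessIntegral _ hr).integrableOn
          ((integrableOn_exp_mul_Iic hpr u).mul_const _) measurableSet_Iic fun t ht => ?_
        calc Real.exp (-(r * t)) * excessIntegral (n + 1) t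
            = Real.exp ((p - r) * t) * (Real.exp (-(p * t)) * excessIntegral (n + 1) t) := by
              rw [← mul_assoc, ← Real.exp_add]; ring_nf
          _ ≤ _ := mul_le_mul_of_nonneg_left (hmono ht Set.self_mem_Iic ht) (Real.exp_nonneg _)
    _ = _ := by
        rw [integral_mul_const, integral_exp_mul_Iic hpr, div_mul_eq_mul_div, ← mul_assoc,
          ← Real.exp_add]
        ring_nf

lemma setIntegral_Ioi_exp_mul_excessIntegral_le (n : ℕ) {r p u : ℝ} (hr : 0 < r) (hpr : p < r)
    (hu : 0 < u) (h : volume.real (truncatedCube (n + 1) u) ≤ p * excessIntegral (n + 1) u) :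
    ∫ t in Set.Ioi u, Real.exp (-(r * t)) * excessIntegral (n + 1) t ≤
      Real.exp (-(r * u)) * excessIntegral (n + 1) u / (r - p) := by
  have hpr' := sub_neg.2 hpr
  have hanti := antitoneOn_exp_mul_excessIntegral n hu h
  calc ∫ t in Set.Ioi u, Real.exp (-(r * t)) * excessIntegral (n + 1) t
      ≤ ∫ t in Set.Ioi u, Real.exp ((p - r) * t) *
          (Real.exp (-(p * u)) * excessIntegral (n + 1) u) := by
        refine setIntegral_mono_on (integrable_exp_mul_excessIntegral _ hr).integrableOn
          ((integrableOn_exp_mul_Ioi hpr' u).mul_const _) measurableSet_Ioi fun t ht => ?_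
        calc Real.exp (-(r * t)) * excessIntegral (n + 1) t
            = Real.exp ((p - r) * t) * (Real.exp (-(p * t)) * excessIntegral (n + 1) t) := by
              rw [← mul_assoc, ← Real.exp_add]; ring_nf
          _ ≤ _ := mul_le_mul_of_nonneg_left
              (hanti Set.self_mem_Ici (le_of_lt (Set.mem_Ioi.1 ht)) (le_of_lt ht))
              (Real.exp_nonneg _)
    _ = _ := by
        rw [integral_mul_const, integral_exp_mul_Ioi hpr', neg_div, ← div_neg, neg_sub,
          div_mul_eq_mul_div, ← mul_assoc, ← Real.exp_add]
        ring_nf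

/-- The left part is bounded through the value at u, the right part by Chernoff at q. For q = μ and
large n the conclusion will fail, refuting V/W ≥ p. -/
lemma laplace_pow_le_of_monotone (n : ℕ) {q r p u : ℝ} (hq : 0 < q) (hqr : q < r) (hrp : r < p)
    (hu : 0 < u) (h : p * excessIntegral (n + 1) u ≤ volume.real (truncatedCube (n + 1) u)) :
    uniformLaplace r ^ (n + 1) / r ^ 2 ≤
      Real.exp (-((r - q) * u)) * (uniformLaplace q ^ (n + 1) / q ^ 2) *
        (1 + Real.exp q / |p - r|) := by
  have hr := hq.trans hqr
  rw [← integral_exp_mul_excessIntegral hr, ← setIntegral_univ, ← Set.Iic_union_Ioi (a := u),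
    setIntegral_union (Set.Iic_disjoint_Ioi le_rfl) measurableSet_Ioi
    (integrable_exp_mul_excessIntegral _ hr).integrableOn
    (integrable_exp_mul_excessIntegral _ hr).integrableOn, abs_of_pos (sub_pos.2 hrp)]
  have h1 := setIntegral_Iic_exp_mul_excessIntegral_le n hr hrp hu h
  have h2 := div_le_div_of_nonneg_right
    (exp_mul_excessIntegral_le_exp_mul_laplace (r := r) (n + 1) hq u) (sub_pos.2 hrp).le
  have h3 := setIntegral_exp_mul_le_of_forall (n + 1) hq hr u (measurableSet_Ioi (a := u))
    fun t ht => mul_le_mul_of_nonneg_left (le_of_lt ht) (sub_nonneg.2 hqr.le)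
  refine (add_le_add (h1.trans h2) h3).trans (le_of_eq ?_)
  ring

lemma laplace_pow_le_of_antitone (n : ℕ) {q r p u : ℝ} (hp : 0 < p) (hpr : p < r) (hrq : r < q)
    (hu : 0 < u) (h : volume.real (truncatedCube (n + 1) u) ≤ p * excessIntegral (n + 1) u) :
    uniformLaplace r ^ (n + 1) / r ^ 2 ≤
      Real.exp (-((r - q) * u)) * (uniformLaplace q ^ (n + 1) / q ^ 2) *
        (1 + Real.exp q / |p - r|) := by
  have hr := hp.trans hpr
  have hq := hr.trans hrq
  rw [← integral_exp_mul_excessIntegral hr, ← setIntegral_univ, ← Set.Iic_union_Ioi (a := u),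
    setIntegral_union (Set.Iic_disjoint_Ioi le_rfl) measurableSet_Ioi
    (integrable_exp_mul_excessIntegral _ hr).integrableOn
    (integrable_exp_mul_excessIntegral _ hr).integrableOn, abs_sub_comm,
    abs_of_pos (sub_pos.2 hpr)]
  have h1 := setIntegral_Ioi_exp_mul_excessIntegral_le n hr hpr hu h
  have h2 := div_le_div_of_nonneg_right
    (exp_mul_excessIntegral_le_exp_mul_laplace (r := r) (n + 1) hq u) (sub_pos.2 hpr).le
  have h3 := setIntegral_exp_mul_le_of_forall (n + 1) hq hr u (measurableSet_Iic (a := u))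
    fun t ht => mul_le_mul_of_nonpos_left ht (sub_nonpos.2 hrq.le)
  refine (add_le_add h3 (h1.trans h2)).trans (le_of_eq ?_)
  ring

/-! ### The equation for μ and the minimum of L(r) e^{αr} -/

/-- The mean of the density proportional to `exp (-r x)` on the unit interval. -/
noncomputable def tiltedMean (r : ℝ) : ℝ := 1 / r - 1 / (Real.exp r - 1)

lemma exp_sub_one_pos {x : ℝ} (hx : 0 < x) : 0 < Real.exp x - 1 :=
  sub_pos.2 (Real.one_lt_exp_iff.2 hx)

lemma hasDerivAt_tiltedMean {x : ℝ} (hx : 0 < x) :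
    HasDerivAt tiltedMean (-1 / x ^ 2 + Real.exp x / (Real.exp x - 1) ^ 2) x := by
  have h1 : HasDerivAt (fun x : ℝ => 1 / x) (-1 / x ^ 2) x := by
    simpa using (hasDerivAt_id' x).fun_inv hx.ne'
  have h2 : HasDerivAt (fun x : ℝ => 1 / (Real.exp x - 1))
      (-Real.exp x / (Real.exp x - 1) ^ 2) x := by
    simpa using ((Real.hasDerivAt_exp x).sub_const 1).fun_inv (exp_sub_one_pos hx).ne'
  refine (h1.sub h2).congr_deriv ?_
  ring

lemma continuousOn_tiltedMean : ContinuousOn tiltedMean (Set.Ioi 0) :=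
  fun _ hx => (hasDerivAt_tiltedMean hx).continuousAt.continuousWithinAt

/-- Negativity of the derivative is x e^{x/2} < e^x - 1, that is, x/2 < sinh (x/2). -/
lemma strictAntiOn_tiltedMean : StrictAntiOn tiltedMean (Set.Ioi 0) := by
  refine strictAntiOn_of_deriv_neg (convex_Ioi 0) continuousOn_tiltedMean fun x hx => ?_
  rw [interior_Ioi] at hx
  have hx : 0 < x := hx
  rw [(hasDerivAt_tiltedMean hx).deriv]
  have he := exp_sub_one_pos hx
  have hs : x / 2 < Real.sinh (x / 2) := Real.self_lt_sinh_iff.2 (half_pos hx)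
  set y := Real.exp (x / 2) with hy
  have hypos : 0 < y := Real.exp_pos _
  have hexp : Real.exp x = y ^ 2 := by rw [hy, ← Real.exp_nat_mul]; congr 1; push_cast; ring
  have h1 : x * y < Real.exp x - 1 := by
    rw [Real.sinh_eq, Real.exp_neg, ← hy] at hs
    have h2 : x < y - y⁻¹ := by linarith
    have h3 := mul_lt_mul_of_pos_right h2 hypos
    rw [sub_mul, inv_mul_cancel₀ hypos.ne'] at h3
    rw [hexp]
    linarith
  have h2 : x ^ 2 * Real.exp x < (Real.exp x - 1) ^ 2 := by
    rw [hexp, ← mul_pow, ← hexp]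
    exact pow_lt_pow_left₀ h1 (by positivity) two_ne_zero
  rw [neg_div, neg_add_lt_iff_lt_add, add_zero, div_lt_div_iff₀ (by positivity) (by positivity)]
  linarith

lemma existsUnique_tiltedMean_eq {α : ℝ} (hα : α ∈ Set.Ioo (0 : ℝ) (1 / 2)) :
    ∃! μ : ℝ, 0 < μ ∧ α = tiltedMean μ := by
  obtain ⟨h0, h2⟩ := hα
  have hinv : 2 < 1 / α := by rw [lt_div_iff₀ h0]; linarith
  -- From e^a - 1 ≥ a + a²/2 the tilted mean at a is at least 1/(2 + a), which is at least α once a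
  -- ≤ 1/α - 2.
  set a := (1 / α - 2) / 2 with ha
  have hapos : 0 < a := by rw [ha]; linarith
  have hab : a ≤ 1 / α := by rw [ha]; linarith
  have hlow : tiltedMean (1 / α) ≤ α := by
    have := one_div_pos.2 (exp_sub_one_pos (one_div_pos.2 h0))
    rw [tiltedMean, one_div_one_div]
    linarith
  have hhigh : α ≤ tiltedMean a := by
    have h3 := Real.quadratic_le_exp_of_nonneg hapos.le
    have h4 : 1 / (Real.exp a - 1) ≤ 1 / (a + a ^ 2 / 2) :=
      one_div_le_one_div_of_le (by positivity) (by linarith)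
    have h5 : 1 / a - 1 / (a + a ^ 2 / 2) = 1 / (2 + a) := by
      field_simp
      ring
    have h6 : α ≤ 1 / (2 + a) := by
      rw [le_one_div h0 (by positivity), ha]
      linarith
    rw [tiltedMean]
    linarith
  have hcont : ContinuousOn tiltedMean (Set.Icc a (1 / α)) :=
    continuousOn_tiltedMean.mono fun x hx => hapos.trans_le hx.1
  obtain ⟨μ, hμ, hμeq⟩ := intermediate_value_Icc' hab hcont ⟨hlow, hhigh⟩
  have hμ0 : 0 < μ := hapos.trans_le hμ.1
  exact ⟨μ, ⟨hμ0, hμeq.symm⟩, fun ν hν =>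
    strictAntiOn_tiltedMean.injOn hν.1 hμ0 (hν.2.symm.trans hμeq.symm)⟩

lemma hasDerivAt_uniformLaplace_mul_exp (α : ℝ) {x : ℝ} (hx : 0 < x) :
    HasDerivAt (fun x => uniformLaplace x * Real.exp (α * x))
      (uniformLaplace x * Real.exp (α * x) * (α - tiltedMean x)) x := by
  have h1 : HasDerivAt uniformLaplace
      ((Real.exp (-x) * x - (1 - Real.exp (-x))) / x ^ 2) x := by
    have h : HasDerivAt (fun x => 1 - Real.exp (-x)) (Real.exp (-x)) x := by
      simpa using ((hasDerivAt_neg x).exp).const_sub 1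
    exact (h.div (hasDerivAt_id x) hx.ne').congr_deriv (by simp)
  have h2 : HasDerivAt (fun x => Real.exp (α * x)) (Real.exp (α * x) * α) x := by
    simpa using ((hasDerivAt_id x).const_mul α).exp
  refine (h1.mul h2).congr_deriv ?_
  have he := (exp_sub_one_pos hx).ne'
  rw [uniformLaplace, tiltedMean, Real.exp_neg]
  field_simp
  ring

lemma uniformLaplace_mul_exp_lt {α μ r : ℝ} (hμ : 0 < μ) (h : α = tiltedMean μ) (hr : 0 < r)
    (hne : r ≠ μ) :
    uniformLaplace μ * Real.exp (α * μ) < uniformLaplace r * Real.exp (α * r) := by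
  have hd := fun x hx => hasDerivAt_uniformLaplace_mul_exp α (x := x) hx
  have hpos : ∀ x, 0 < x → 0 < uniformLaplace x * Real.exp (α * x) := fun x hx =>
    mul_pos (uniformLaplace_pos hx) (Real.exp_pos _)
  rcases hne.lt_or_gt with hlt | hgt
  · refine strictAntiOn_of_deriv_neg (convex_Icc r μ)
      (fun x hx => (hd x (hr.trans_le hx.1)).continuousAt.continuousWithinAt) (fun x hx => ?_)
      (Set.left_mem_Icc.2 hlt.le) (Set.right_mem_Icc.2 hlt.le) hlt
    rw [interior_Icc] at hx
    have hx0 := hr.trans hx.1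
    rw [(hd x hx0).deriv, h]
    exact mul_neg_of_pos_of_neg (h ▸ hpos x hx0)
      (sub_neg.2 (strictAntiOn_tiltedMean hx0 hμ hx.2))
  · refine strictMonoOn_of_deriv_pos (convex_Icc μ r)
      (fun x hx => (hd x (hμ.trans_le hx.1)).continuousAt.continuousWithinAt) (fun x hx => ?_)
      (Set.left_mem_Icc.2 hgt.le) (Set.right_mem_Icc.2 hgt.le) hgt
    rw [interior_Icc] at hx
    have hx0 := hμ.trans hx.1
    rw [(hd x hx0).deriv, h]
    exact mul_pos (h ▸ hpos x hx0) (sub_pos.2 (strictAntiOn_tiltedMean hμ hx0 hx.1))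

/-! ### The limit of the optimal parameter -/

lemma eventually_lt_laplace_pow {α μ r : ℝ} (hμ : 0 < μ) (h : α = tiltedMean μ) (hr : 0 < r)
    (hne : r ≠ μ) (c K : ℝ) :
    ∀ᶠ n : ℕ in atTop, Real.exp (-((r - μ) * ((n + 1) * α + c))) *
      (uniformLaplace μ ^ (n + 1) / μ ^ 2) * K < uniformLaplace r ^ (n + 1) / r ^ 2 := by
  have hlt := uniformLaplace_mul_exp_lt hμ h hr hne
  set A := uniformLaplace μ * Real.exp (α * μ) with hA
  set B := uniformLaplace r * Real.exp (α * r) with hB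
  have hApos : 0 < A := mul_pos (uniformLaplace_pos hμ) (Real.exp_pos _)
  have hlim : Tendsto (fun n : ℕ => (B / A) ^ (n + 1)) atTop atTop :=
    (tendsto_add_atTop_iff_nat 1).2 (tendsto_pow_atTop_atTop_of_one_lt ((one_lt_div hApos).2 hlt))
  filter_upwards [hlim.eventually_gt_atTop (Real.exp (-((r - μ) * c)) / μ ^ 2 * K * r ^ 2)]
    with n hn
  rw [div_pow, lt_div_iff₀ (by positivity), hA, hB, mul_pow, mul_pow, ← Real.exp_nat_mul,
    ← Real.exp_nat_mul] at hn
  push_cast at hn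
  have e1 : Real.exp (-((r - μ) * ((n + 1) * α + c))) = Real.exp (-((r - μ) * c)) *
      Real.exp ((n + 1) * (α * μ)) / Real.exp ((n + 1) * (α * r)) := by
    rw [← Real.exp_add, ← Real.exp_sub]
    ring_nf
  rw [e1, lt_div_iff₀ (by positivity)]
  refine lt_of_mul_lt_mul_right ?_ (Real.exp_nonneg ((n + 1) * (α * r)))
  refine lt_of_eq_of_lt ?_ hn
  field_simp

lemma tendsto_optimalShapingParameter_sub {α μ : ℝ} (hα : α ∈ Set.Ioo (0 : ℝ) (1 / 2))
    (hμ : 0 < μ) (h : α = tiltedMean μ) :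
    Tendsto (fun n : ℕ => optimalShapingParameter (n + 1) α - (n + 1) * α) atTop
      (nhds (1 / μ)) := by
  have hpos : ∀ (n : ℕ) (y : ℝ), 0 < y → 0 < (n + 1) * α + y := fun n y hy =>
    add_pos (mul_pos (by positivity) hα.1) hy
  refine tendsto_order.2 ⟨fun a ha => ?_, fun b hb => ?_⟩
  -- The maximum with 0 keeps y positive, so that 1/y can serve as the rate p.
  · obtain ⟨y, hy, hyμ⟩ := exists_between (max_lt ha (one_div_pos.2 hμ))
    have hy0 : 0 < y := (le_max_right _ _).trans_lt hy
    have hμy : μ < 1 / y := (lt_one_div hy0 hμ).1 hyμ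
    obtain ⟨r, hμr, hry⟩ := exists_between hμy
    filter_upwards [eventually_lt_laplace_pow hμ h (hμ.trans hμr) hμr.ne' y
      (1 + Real.exp μ / |1 / y - r|)] with n hn
    have hu := hpos n y hy0
    have hlt := not_le.1 fun hle => hn.not_ge (laplace_pow_le_of_monotone n hμ hμr hry hu hle)
    obtain ⟨ht, hteq⟩ := optimalShapingParameter_spec hα n
    have hV := volume_truncatedCube_pos n hu
    -- At u = (n + 1)α + y, V < W/y reads W/V > y, that is, u - W/V < (n + 1)α.
    have hP : averageFirstMoment (n + 1) ((n + 1) * α + y) < α := by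
      rw [averageFirstMoment_succ n hu, div_lt_iff₀ (by positivity)]
      rw [one_div_mul_eq_div, lt_div_iff₀ hy0, ← lt_div_iff₀' hV] at hlt
      linarith
    have hut := not_le.1 fun hle =>
      hP.not_ge (hteq.ge.trans (averageFirstMoment_monotoneOn n ht.1 hu hle))
    linarith [le_max_left a 0]
  · obtain ⟨y, hμy, hyb⟩ := exists_between hb
    have hy0 : 0 < y := (one_div_pos.2 hμ).trans hμy
    have hyμ : 1 / y < μ := (one_div_lt hμ hy0).1 hμy
    obtain ⟨r, hyr, hrμ⟩ := exists_between hyμ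
    have hy0' : 0 < 1 / y := one_div_pos.2 hy0
    filter_upwards [eventually_lt_laplace_pow hμ h (hy0'.trans hyr) hrμ.ne y
      (1 + Real.exp μ / |1 / y - r|)] with n hn
    have hu := hpos n y hy0
    have hlt := not_le.1 fun hle => hn.not_ge (laplace_pow_le_of_antitone n hy0' hyr hrμ hu hle)
    obtain ⟨ht, hteq⟩ := optimalShapingParameter_spec hα n
    have hV := volume_truncatedCube_pos n hu
    have hP : α < averageFirstMoment (n + 1) ((n + 1) * α + y) := by
      rw [averageFirstMoment_succ n hu, lt_div_iff₀ (by positivity)]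
      rw [one_div_mul_eq_div, div_lt_iff₀ hy0, ← div_lt_iff₀' hV] at hlt
      linarith
    have hut := not_le.1 fun hle =>
      hP.not_ge ((averageFirstMoment_monotoneOn n hu ht.1 hle).trans hteq.le)
    linarith

theorem theorem2 (α : ℝ) (hα : α ∈ Set.Ioo (0 : ℝ) (1 / 2)) :
    -- for every `n ≥ 1` the number `P_n⁻¹(α)` is well defined
    (∀ n : ℕ, 1 ≤ n → ∃! t : ℝ, t ∈ Set.Ioc (0 : ℝ) n ∧ averageFirstMoment n t = α) ∧
    -- and it is the parameter of the optimal shaping region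
    (∀ n : ℕ, 1 ≤ n →
      IsOptimalShapingRegion n α (truncatedCube n (optimalShapingParameter n α))) ∧
    -- the equation for `μ` has exactly one positive solution, and the expansion holds with it
    (∃! μ : ℝ, 0 < μ ∧ α = 1 / μ - 1 / (Real.exp μ - 1)) ∧
    (∀ μ : ℝ, 0 < μ → α = 1 / μ - 1 / (Real.exp μ - 1) →
      (fun n : ℕ => optimalShapingParameter n α / n - (α + 1 / μ * (1 / (n : ℝ))))
        =o[atTop] (fun n : ℕ => 1 / (n : ℝ))) := by
  refine ⟨fun n hn => ?_, fun n hn => ?_, existsUnique_tiltedMean_eq hα, fun μ hμ h => ?_⟩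
  · obtain ⟨n, rfl⟩ := Nat.exists_eq_add_of_le' hn
    push_cast
    exact existsUnique_averageFirstMoment_eq hα n
  · obtain ⟨n, rfl⟩ := Nat.exists_eq_add_of_le' hn
    obtain ⟨ht, hteq⟩ := optimalShapingParameter_spec hα n
    exact isOptimalShapingRegion_truncatedCube ht.1 hteq
  · have hlim : Tendsto (fun n : ℕ => optimalShapingParameter n α - n * α - 1 / μ) atTop
        (nhds 0) := by
      rw [← tendsto_add_atTop_iff_nat 1, ← sub_self (1 / μ)]
      push_cast
      exact (tendsto_optimalShapingParameter_sub hα hμ h).sub_const _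
    -- The error is exactly (t_n^⋆ - nα - 1/μ) · (1/n) for n > 0.
    refine isLittleO_iff_exists_eq_mul.2 ⟨_, hlim, ?_⟩
    filter_upwards [eventually_gt_atTop 0] with n hn
    have : (n : ℝ) ≠ 0 := by exact_mod_cast hn.ne'
    simp only [Pi.mul_apply]
    field_simp
    ring
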